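/- Consider a stochastic bandit with $K$ arms. Arm $i$ has a reward distribution with CDF $F_i$ and finite mean $\mu_i\ge 0$; the arm $i^*$ with the largest mean $\mu^*=\mu_{i^*}$ is unique, and $\Delta_j=\mu^*-\mu_j$. In each round $t=1,2,\dots$ the player pulls an arm $I_t$, which generates a clean reward $\tilde X_{I_t,t}$ distributed according to $F_{I_t}$ independently of the past. Independently of the past and of the choice of $I_t$, an adversary attacks in round $t$ with probability $\rho$. If it attacks, the player observes $\tilde X_{I_t,t}+\eta_t$, otherwise $\tilde X_{I_t,t}$. The attack value $\eta_t\in\mathbb R$ is arbitrary and unbounded; it may depend adaptively on everything that has happened so far, including the current round. The median-based $\epsilon$-greedy algorithm (med-$\epsilon$-greedy) with parameter $c$ first pulls each arm $\lceil c\rceil$ times. In each round $t>\lceil c\rceil K$ it pulls, with probability $cK/t$, an arm drawn uniformly from all $K$ arms, and otherwise an arm $j$ that maximizes $\mathrm{med}_j(t-1)$, with ties broken arbitrarily. Here $\mathrm{med}_j(t)$ is the sample median $\inf\{x:\hat F(x)\ge \tfrac12\}$ of the rewards observed from arm $j$ up to round $t$, with $\hat F$ their empirical CDF. The regret after $T$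 rounds is the random variable $R_T=\mu^*T-\sum_{t=1}^T\mu_{I_t}$. Suppose that there are constants $0<s<1$ and $x_0\in\mathbb R$ with $F_{i^*}(x_0)<\frac12-s$ and $F_j(x_0)>\frac12+s$ for all $j\ne i^*$, that $\rho<s$, and that $$c>\max\Big\{40,\ \frac{4}{(F_j(x_0)-\frac12-s)^2}\ (j\ne i^*),\ \frac{4}{(\frac12-s-F_{i^*}(x_0))^2},\ \frac{1}{(s-\rho)^2}\Big\}.$$ Then for every $T\ge1$ and every $0<\delta<1$, with probability at least $1-\delta$, $$R_T\le\frac{6\lceil c\rceil^2K^3}{\delta}\,\mu^*+\sum_{j\ne i^*}2c\Delta_j\log T+\sum_{j\ne i^*}2c\Delta_j .$$ Moreover, there is a constant $M>0$ that depends only on $K$, $c$ and the gaps $\Delta_j$ such that, for every $T\ge1$ and every $0<\delta<1$, $R_T\le M\left(\log T+\frac1\delta\right)$ with probability at least $1-\delta$. -/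

import Mathlib

open MeasureTheory ProbabilityTheory

noncomputable section

/-- Generalized `p`-quantile of a distribution function: `inf {x | p ≤ F x}`. -/
def quantile (p : ℝ) (F : ℝ → ℝ) : ℝ := sInf {x : ℝ | p ≤ F x}

/-- Empirical distribution function of the finite sample `(x τ)_{τ ∈ S}`. -/
def empiricalCDF (S : Finset ℕ) (x : ℕ → ℝ) (y : ℝ) : ℝ :=
  ((S.filter fun τ => x τ ≤ y).card : ℝ) / (S.card : ℝ)

/-- Sample median: the generalized `1/2`-quantile of the empirical distribution. -/
def sampleMedian (S : Finset ℕ) (x : ℕ → ℝ) : ℝ := quantile (1 / 2) (empiricalCDF S x)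

/-- Mean of a reward distribution. -/
def rewardMean (ν : Measure ℝ) : ℝ := ∫ x, x ∂ν

/-- The random quantities occurring in a run of a `K`-armed bandit under attack. The rounds are
`1, 2, 3, …`; the values at index `0` play no role. -/
structure BanditRun (K : ℕ) (Ω : Type*) where
  /-- `clean t i` is the unattacked reward that arm `i` generates if it is pulled in round `t`. -/
  clean : ℕ → Fin K → Ω → ℝ
  /-- whether the adversary attacks in round `t` -/
  attacked : ℕ → Ω → Bool
  /-- the attack value of round `t` -/
  attackValue : ℕ → Ω → ℝ
  /-- the player's coin of round `t`: explore (`true`) or exploit (`false`) -/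
  explore : ℕ → Ω → Bool
  /-- the arm that the player draws for the case of exploration in round `t` -/
  pick : ℕ → Ω → Fin K
  /-- the arm pulled in round `t` -/
  arm : ℕ → Ω → Fin K

namespace BanditRun

variable {K : ℕ} {Ω : Type*}

/-- The reward that the player observes when pulling arm `i` in round `t`. -/
def observed (R : BanditRun K Ω) (t : ℕ) (i : Fin K) (ω : Ω) : ℝ :=
  if R.attacked t ω = true then R.clean t i ω + R.attackValue t ω else R.clean t i ω

/-- The rounds among `1, …, t` in which arm `i` is pulled. -/
def pullRounds (R : BanditRun K Ω) (i : Fin K) (t : ℕ) (ω : Ω) : Finset ℕ :=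
  (Finset.Icc 1 t).filter fun τ => R.arm τ ω = i

/-- The sample median of the rewards observed from arm `i` up to round `t`. -/
def med (R : BanditRun K Ω) (i : Fin K) (t : ℕ) (ω : Ω) : ℝ :=
  sampleMedian (R.pullRounds i t ω) fun τ => R.observed τ i ω

/-- The realized regret `μ* T - ∑_{t = 1}^T μ_{I_t}` after `T` rounds, where `istar` is the best
arm. -/
def regret (R : BanditRun K Ω) (ν : Fin K → Measure ℝ) (istar : Fin K) (T : ℕ) (ω : Ω) : ℝ :=
  rewardMean (ν istar) * (T : ℝ) - ∑ t ∈ Finset.Icc 1 T, rewardMean (ν (R.arm t ω))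

/-- The σ-algebra generated by the player's two coins of round `t`. -/
abbrev coins (R : BanditRun K Ω) (t : ℕ) : MeasurableSpace Ω :=
  MeasurableSpace.comap (R.explore t) inferInstance ⊔
    MeasurableSpace.comap (R.pick t) inferInstance

/-- The stochastic bandit with reward distributions `ν i` and attack probability `ρ`.
`ℱ t` is everything that has happened up to the end of round `t` (and possibly private randomness
of the adversary and of the player). In round `t + 1`, the clean reward of each arm has
distribution `ν i`, an attack occurs with probability `ρ`, and each of these is independent of
the past and of the player's coins, hence of the arm chosen in that round. The attack value is any
`ℱ (t + 1)`-measurable real random variable: it may depend on the whole past as well as on the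
arm, the reward and the attack indicator of the current round, and nothing is assumed about
its law. -/
structure IsAttackedBandit [mΩ : MeasurableSpace Ω] (R : BanditRun K Ω) (P : Measure Ω)
    (ℱ : Filtration ℕ mΩ) (ν : Fin K → Measure ℝ) (ρ : ℝ) : Prop where
  clean_meas : ∀ t i, Measurable[ℱ t] (R.clean t i)
  attacked_meas : ∀ t, Measurable[ℱ t] (R.attacked t)
  attackValue_meas : ∀ t, Measurable[ℱ t] (R.attackValue t)
  clean_law : ∀ t i, P.map (R.clean (t + 1) i) = ν i
  clean_indep : ∀ t i, Indep (MeasurableSpace.comap (R.clean (t + 1) i) inferInstance)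
    (ℱ t ⊔ R.coins (t + 1)) P
  attacked_prob : ∀ t, P.real {ω | R.attacked (t + 1) ω = true} = ρ
  attacked_indep : ∀ t, Indep (MeasurableSpace.comap (R.attacked (t + 1)) inferInstance)
    (ℱ t ⊔ R.coins (t + 1)) P

/-- The arms are pulled by the median-based `ε`-greedy algorithm with exploration parameter `c`.
In the first `⌈c⌉ K` rounds every arm is pulled `⌈c⌉` times (in any order). In each later round
`t + 1`, with probability `c K / (t + 1)` the player pulls a uniformly drawn arm, and otherwise
an arm that maximizes the current sample median (ties are broken arbitrarily). The player's
coins are fresh randomness, and the choice of the arm is based on the past and the coins only. -/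
structure IsMedEpsGreedy [mΩ : MeasurableSpace Ω] (R : BanditRun K Ω) (P : Measure Ω)
    (ℱ : Filtration ℕ mΩ) (c : ℝ) : Prop where
  explore_meas : ∀ t, Measurable[ℱ t] (R.explore t)
  pick_meas : ∀ t, Measurable[ℱ t] (R.pick t)
  arm_meas : ∀ t, Measurable[ℱ t ⊔ R.coins (t + 1)] (R.arm (t + 1))
  init : ∀ ω i, (R.pullRounds i (⌈c⌉₊ * K) ω).card = ⌈c⌉₊
  explore_prob : ∀ t, ⌈c⌉₊ * K ≤ t →
    P.real {ω | R.explore (t + 1) ω = true} = c * (K : ℝ) / ((t + 1 : ℕ) : ℝ)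
  pick_prob : ∀ t, ⌈c⌉₊ * K ≤ t → ∀ i, P.real {ω | R.pick (t + 1) ω = i} = 1 / (K : ℝ)
  explore_indep_pick : ∀ t, ⌈c⌉₊ * K ≤ t → IndepFun (R.explore (t + 1)) (R.pick (t + 1)) P
  coins_indep : ∀ t, ⌈c⌉₊ * K ≤ t → Indep (R.coins (t + 1)) (ℱ t) P
  arm_explore : ∀ t, ⌈c⌉₊ * K ≤ t → ∀ ω, R.explore (t + 1) ω = true →
    R.arm (t + 1) ω = R.pick (t + 1) ω
  arm_exploit : ∀ t, ⌈c⌉₊ * K ≤ t → ∀ ω, R.explore (t + 1) ω = false →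
    ∀ j, R.med j t ω ≤ R.med (R.arm (t + 1) ω) t ω

end BanditRun

end

open MeasureTheory ProbabilityTheory

/-! ### Sample medians -/

/-! An unbounded attack moves a median across `x₀` only by being frequent. If, among the pulls of
every arm, fewer than a fraction `1/2 - s` of the clean rewards lie on the wrong side of `x₀` and
fewer than a fraction `s` are attacked, then every sample median lies on its correct side, and
exploitation picks `istar` (`arm_eq_of_exploit`). Regret therefore comes only from the initial
rounds, from exploration, and from rounds whose history is `misleading` (`regret_le`).

The key point is that the expected number of misleading rounds is bounded uniformly in `T`. For a
`[0, 1]`-valued quantity of mean `p < θ`, the exponential of its tilted sum over the pulls of an arm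
is at least `1` whenever the average reaches `θ`. By Hoeffding's lemma each pull multiplies its
expectation by an independent factor of mean at most `1 - (3/2)/c`. Exploration alone pulls the arm
in round `t + 1` with probability `c/(t+1)`, so the expectation shrinks by `1 - (3/2)/(t+1)` per
round, which is fast enough to be summable (`sum_measureReal_le`). Adaptive pulls only help, so no
separate bound on the number of pulls is needed.

Markov's inequality then controls the number of misleading rounds, and Chebyshev's the exploration
cost, whose mean is logarithmic; together they fail with probability at most `3δ/4` (`regret_whp`).
-/

theorem sampleMedian_le {S : Finset ℕ} {x : ℕ → ℝ} {x₀ : ℝ} (hS : S.Nonempty)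
    (h : (S.card : ℝ) / 2 ≤ (S.filter fun τ => x τ ≤ x₀).card) : sampleMedian S x ≤ x₀ := by
  have hpos : (0 : ℝ) < S.card := by exact_mod_cast hS.card_pos
  refine csInf_le ⟨S.inf' hS x, ?_⟩ ?_
  · intro y hy
    by_contra! hlt
    have : S.filter (fun τ => x τ ≤ y) = ∅ := by
      refine Finset.filter_eq_empty_iff.2 fun τ hτ => not_le.2 (hlt.trans_le ?_)
      exact Finset.inf'_le x hτ
    simp only [Set.mem_ofPred_eq, empiricalCDF, this] at hy
    norm_num at hy
  · simp only [Set.mem_ofPred_eq, empiricalCDF]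
    rw [le_div_iff₀ hpos]
    linarith

/-- The inequality is strict because the empirical CDF is constant from `x₀` up to the next sample
point, which bounds the median from below. -/
theorem lt_sampleMedian {S : Finset ℕ} {x : ℕ → ℝ} {x₀ : ℝ}
    (h : ((S.filter fun τ => x τ ≤ x₀).card : ℝ) < (S.card : ℝ) / 2) :
    x₀ < sampleMedian S x := by
  have hpos : (0 : ℝ) < S.card := by
    have : (0 : ℝ) ≤ (S.filter fun τ => x τ ≤ x₀).card := by positivity
    linarith
  have hS : S.Nonempty := by
    rw [← Finset.card_pos]; exact_mod_cast hpos
  have hne : (S.filter fun τ => x₀ < x τ).Nonempty := by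
    by_contra hemp
    rw [Finset.not_nonempty_iff_eq_empty, Finset.filter_eq_empty_iff] at hemp
    rw [Finset.filter_true_of_mem fun τ hτ => not_lt.1 (hemp hτ)] at h
    linarith
  obtain ⟨τ₀, hτ₀, hmin⟩ := Finset.exists_min_image _ x hne
  refine (Finset.mem_filter.1 hτ₀).2.trans_le (le_csInf ⟨S.sup' hS x, ?_⟩ fun y hy => ?_)
  · simp only [Set.mem_ofPred_eq, empiricalCDF]
    rw [Finset.filter_true_of_mem fun τ hτ => Finset.le_sup' x hτ, div_self hpos.ne']
    norm_num
  · by_contra! hlt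
    simp only [Set.mem_ofPred_eq, empiricalCDF] at hy
    rw [le_div_iff₀ hpos] at hy
    have : (S.filter fun τ => x τ ≤ y).card ≤ (S.filter fun τ => x τ ≤ x₀).card := by
      refine Finset.card_le_card fun τ hτ => ?_
      simp only [Finset.mem_filter] at hτ ⊢
      refine ⟨hτ.1, ?_⟩
      by_contra! hx
      have := hmin τ (Finset.mem_filter.2 ⟨hτ.1, hx⟩)
      linarith [hτ.2]
    have : ((S.filter fun τ => x τ ≤ y).card : ℝ) ≤ (S.filter fun τ => x τ ≤ x₀).card := by
      exact_mod_cast this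
    linarith

/-! ### Hoeffding's lemma for one bounded reward -/

/-- With gap `g = θ - P[b]`, Hoeffding's exponent `-l g + l² / 8` is minimal at `l = 4 g`, with
value `-2 g²`. -/
theorem integral_exp_sub_le {Ω : Type*} [MeasurableSpace Ω] {P : Measure Ω}
    [IsProbabilityMeasure P] {b : Ω → ℝ} (hb : Measurable b) (hb01 : ∀ ω, b ω ∈ Set.Icc (0 : ℝ) 1)
    (θ : ℝ) :
    ∫ ω, Real.exp (4 * (θ - P[b]) * (b ω - θ)) ∂P ≤ Real.exp (-2 * (θ - P[b]) ^ 2) := by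
  set g := θ - P[b] with hg
  have h := (hasSubgaussianMGF_of_mem_Icc (μ := P) hb.aemeasurable
    (Filter.Eventually.of_forall hb01)).mgf_le (4 * g)
  have heq : ∀ ω, Real.exp (4 * g * (b ω - θ))
      = Real.exp (-4 * g ^ 2) * Real.exp (4 * g * (b ω - P[b])) := by
    intro ω
    rw [← Real.exp_add]
    congr 1
    rw [show P[b] = θ - g by rw [hg]; ring]
    ring
  simp_rw [heq]
  rw [integral_const_mul]
  unfold mgf at h
  calc _ ≤ Real.exp (-4 * g ^ 2) * Real.exp (2 * g ^ 2) := by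
        gcongr
        refine h.trans (le_of_eq ?_)
        congr 1
        push_cast
        norm_num
        ring
    _ = _ := by rw [← Real.exp_add]; ring_nf

theorem exp_neg_two_mul_le {c g : ℝ} (hc : 40 < c) (hg : 1 / c < g ^ 2) :
    Real.exp (-2 * g ^ 2) ≤ 1 - 3 / 2 / c := by
  have hc0 : 0 < c := by linarith
  have h1 : Real.exp (-2 * g ^ 2) ≤ Real.exp (-(2 / c)) := by
    gcongr
    have : 2 / c = 2 * (1 / c) := by ring
    linarith
  refine h1.trans ?_
  rw [Real.exp_neg, inv_le_comm₀ (Real.exp_pos _)]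
  · refine le_trans ?_ (Real.add_one_le_exp _)
    rw [inv_le_iff_one_le_mul₀]
    · field_simp
      nlinarith
    · rw [sub_pos, div_lt_one hc0]; linarith
  · rw [sub_pos, div_lt_one hc0]; linarith

/-- Summation of a sequence whose consecutive ratios are at most `1 - (3 / 2) / (t + 1)`. -/
theorem sum_Ico_le_of_ratio {w : ℕ → ℝ} {m : ℕ} (hw : ∀ t, 0 ≤ w t) (hm : w m ≤ 1)
    (hstep : ∀ t, m ≤ t → w (t + 1) ≤ w t * (1 - 3 / 2 / ((t + 1 : ℕ) : ℝ))) (T : ℕ) :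
    ∑ t ∈ Finset.Ico m T, w t ≤ 2 * m := by
  rcases lt_or_ge T m with h | h
  · rw [Finset.Ico_eq_empty (by omega)]; simp
  -- The potential `2 t w t` drops by at least `w t` in each step, because the rate `3/2` exceeds
  -- `1` by one half; the sum telescopes.
  suffices H : ∑ t ∈ Finset.Ico m T, w t ≤ 2 * m - 2 * T * w T by
    have := hw T
    have : 0 ≤ 2 * (T : ℝ) * w T := by positivity
    linarith
  induction T, h using Nat.le_induction with
  | base =>
    simp only [Finset.Ico_self, Finset.sum_empty]
    have : (0 : ℝ) ≤ m := by positivity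
    nlinarith
  | succ t ht ih =>
    rw [Finset.sum_Ico_succ_top ht]
    have h1 : 2 * ((t + 1 : ℕ) : ℝ) * w (t + 1)
        ≤ 2 * ((t + 1 : ℕ) : ℝ) * (w t * (1 - 3 / 2 / ((t + 1 : ℕ) : ℝ))) := by
      gcongr
      exact hstep t ht
    have h2 : 2 * ((t + 1 : ℕ) : ℝ) * (w t * (1 - 3 / 2 / ((t + 1 : ℕ) : ℝ)))
        = 2 * t * w t - w t := by
      push_cast
      field_simp
      ring
    linarith

/-! ### Exponential scores of the pulls of an arm -/

namespace BanditRun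

variable {K : ℕ} {Ω : Type*}

/-- The exponential of `l` times the centred sum of the values `b τ` over the pulls of arm `i`. -/
noncomputable def expScore (R : BanditRun K Ω) (i : Fin K) (b : ℕ → Ω → ℝ) (l θ : ℝ) (t : ℕ)
    (ω : Ω) : ℝ :=
  ∏ τ ∈ Finset.Icc 1 t, if R.arm τ ω = i then Real.exp (l * (b τ ω - θ)) else 1

theorem expScore_pos (R : BanditRun K Ω) (i : Fin K) (b : ℕ → Ω → ℝ) (l θ : ℝ) (t : ℕ) (ω : Ω) :
    0 < R.expScore i b l θ t ω := by
  refine Finset.prod_pos fun τ _ => ?_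
  split_ifs
  · exact Real.exp_pos _
  · exact one_pos

theorem expScore_eq (R : BanditRun K Ω) (i : Fin K) (b : ℕ → Ω → ℝ) (l θ : ℝ) (t : ℕ) (ω : Ω) :
    R.expScore i b l θ t ω = Real.exp
      (l * ((∑ τ ∈ R.pullRounds i t ω, b τ ω) - θ * (R.pullRounds i t ω).card)) := by
  unfold expScore pullRounds
  rw [← Finset.prod_filter, ← Real.exp_sum, ← Finset.mul_sum, Finset.sum_sub_distrib,
    Finset.sum_const, nsmul_eq_mul, mul_comm θ]

theorem expScore_succ (R : BanditRun K Ω) (i : Fin K) (b : ℕ → Ω → ℝ) (l θ : ℝ) (t : ℕ) (ω : Ω) :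
    R.expScore i b l θ (t + 1) ω = R.expScore i b l θ t ω *
      if R.arm (t + 1) ω = i then Real.exp (l * (b (t + 1) ω - θ)) else 1 := by
  unfold expScore
  rw [Finset.prod_Icc_succ_top (by omega)]

theorem expScore_le (R : BanditRun K Ω) (i : Fin K) {b : ℕ → Ω → ℝ}
    (hb : ∀ t ω, b t ω ∈ Set.Icc (0 : ℝ) 1) (l θ : ℝ) (t : ℕ) (ω : Ω) :
    R.expScore i b l θ t ω ≤ Real.exp (|l| * (1 + |θ|)) ^ t := by
  calc R.expScore i b l θ t ω ≤ ∏ _τ ∈ Finset.Icc 1 t, Real.exp (|l| * (1 + |θ|)) := by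
        refine Finset.prod_le_prod (fun τ _ => ?_) fun τ _ => ?_
        · split_ifs <;> positivity
        · split_ifs
          · refine Real.exp_le_exp.2 ((le_abs_self _).trans ?_)
            rw [abs_mul]
            gcongr
            refine (abs_sub _ _).trans ?_
            gcongr
            exact abs_le.2 ⟨by linarith [(hb τ ω).1], (hb τ ω).2⟩
          · exact Real.one_le_exp (by positivity)
    _ = _ := by simp

theorem explorePick_measurableSet (R : BanditRun K Ω) (t : ℕ) (i : Fin K) :
    MeasurableSet[R.coins t] {ω | R.explore t ω = true ∧ R.pick t ω = i} := by
  refine MeasurableSet.inter (m := R.coins t) ?_ ?_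
  · exact (le_sup_left : _ ≤ R.coins t) _ ⟨{true}, trivial, rfl⟩
  · exact (le_sup_right : _ ≤ R.coins t) _ ⟨{i}, trivial, rfl⟩

variable [mΩ : MeasurableSpace Ω] {P : Measure Ω} {ℱ : Filtration ℕ mΩ}
  {R : BanditRun K Ω} {ν : Fin K → Measure ℝ} {ρ c : ℝ}

namespace IsMedEpsGreedy

theorem coins_le (hG : R.IsMedEpsGreedy P ℱ c) (t : ℕ) : R.coins t ≤ ℱ t :=
  sup_le (hG.explore_meas t).comap_le (hG.pick_meas t).comap_le

theorem past_sup_coins_le (hG : R.IsMedEpsGreedy P ℱ c) (t : ℕ) :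
    ℱ t ⊔ R.coins (t + 1) ≤ ℱ (t + 1) :=
  sup_le (ℱ.mono (Nat.le_succ t)) (hG.coins_le (t + 1))

theorem arm_adapted (hG : R.IsMedEpsGreedy P ℱ c) {t : ℕ} (ht : 1 ≤ t) :
    Measurable[ℱ t] (R.arm t) := by
  obtain ⟨t, rfl⟩ := Nat.exists_eq_add_of_le' ht
  exact (hG.arm_meas t).mono (hG.past_sup_coins_le t) le_rfl

theorem explorePick_prob (hG : R.IsMedEpsGreedy P ℱ c) {t : ℕ} (ht : ⌈c⌉₊ * K ≤ t) (i : Fin K) :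
    P.real {ω | R.explore (t + 1) ω = true ∧ R.pick (t + 1) ω = i} = c / ((t + 1 : ℕ) : ℝ) := by
  have h := (hG.explore_indep_pick t ht).measure_inter_preimage_eq_mul {true} {i}
    trivial trivial
  have hK : (K : ℝ) ≠ 0 := by
    have := i.pos
    positivity
  have h' : P.real {ω | R.explore (t + 1) ω = true ∧ R.pick (t + 1) ω = i}
      = P.real {ω | R.explore (t + 1) ω = true} * P.real {ω | R.pick (t + 1) ω = i} := by
    simp only [Measure.real]
    rw [← ENNReal.toReal_mul]
    exact congrArg ENNReal.toReal h
  rw [h', hG.explore_prob t ht, hG.pick_prob t ht i]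
  field_simp

theorem expScore_adapted (hG : R.IsMedEpsGreedy P ℱ c) (i : Fin K) {b : ℕ → Ω → ℝ}
    (hb : ∀ t, Measurable[ℱ t] (b t)) (l θ : ℝ) (t : ℕ) :
    Measurable[ℱ t] (R.expScore i b l θ t) := by
  unfold expScore
  refine Finset.measurable_fun_prod (m := ℱ t) _ fun τ hτ => ?_
  rw [Finset.mem_Icc] at hτ
  have hle := ℱ.mono hτ.2
  refine Measurable.ite (m := ℱ t) ?_ ?_ measurable_const
  · exact hle _ (hG.arm_adapted hτ.1 (measurableSet_singleton i))
  · exact Real.measurable_exp.comp ((((hb τ).mono hle le_rfl).sub_const θ).const_mul l)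

theorem integrable_expScore [IsProbabilityMeasure P]
    (hG : R.IsMedEpsGreedy P ℱ c) (i : Fin K) {b : ℕ → Ω → ℝ}
    (hb : ∀ t, Measurable[ℱ t] (b t)) (hb01 : ∀ t ω, b t ω ∈ Set.Icc (0 : ℝ) 1)
    (l θ : ℝ) (t : ℕ) : Integrable (R.expScore i b l θ t) P :=
  Integrable.of_mem_Icc 0 _ ((hG.expScore_adapted i hb l θ t).mono (ℱ.le t) le_rfl).aemeasurable
    (Filter.Eventually.of_forall fun ω => ⟨(R.expScore_pos i b l θ t ω).le,
      R.expScore_le i hb01 l θ t ω⟩)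

/-- One step of the score: a pull of arm `i` multiplies it by an independent factor. -/
theorem integral_expScore_succ [IsProbabilityMeasure P]
    (hG : R.IsMedEpsGreedy P ℱ c) (i : Fin K) {b : ℕ → Ω → ℝ}
    (hb : ∀ t, Measurable[ℱ t] (b t)) (hb01 : ∀ t ω, b t ω ∈ Set.Icc (0 : ℝ) 1)
    (hbi : ∀ t, Indep (MeasurableSpace.comap (b (t + 1)) inferInstance)
      (ℱ t ⊔ R.coins (t + 1)) P) (l θ : ℝ) (t : ℕ) :
    P[R.expScore i b l θ (t + 1)] = P[R.expScore i b l θ t]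
      - (1 - ∫ ω, Real.exp (l * (b (t + 1) ω - θ)) ∂P) *
        P[{ω | R.arm (t + 1) ω = i}.indicator (R.expScore i b l θ t)] := by
  set W := R.expScore i b l θ t with hW
  set A := {ω | R.arm (t + 1) ω = i} with hA
  set Y : Ω → ℝ := fun ω => Real.exp (l * (b (t + 1) ω - θ)) with hY
  have hAm : MeasurableSet[ℱ t ⊔ R.coins (t + 1)] A := hG.arm_meas t (measurableSet_singleton i)
  have hle : ℱ t ⊔ R.coins (t + 1) ≤ mΩ := (hG.past_sup_coins_le t).trans (ℱ.le _)
  have hfm : Measurable[ℱ t ⊔ R.coins (t + 1)] (A.indicator W) :=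
    Measurable.indicator ((hG.expScore_adapted i hb l θ t).mono le_sup_left le_rfl) hAm
  have hWint : Integrable W P := hG.integrable_expScore i hb hb01 l θ t
  have hfint : Integrable (A.indicator W) P := hWint.indicator (hle _ hAm)
  have hYm : Measurable[MeasurableSpace.comap (b (t + 1)) inferInstance] Y :=
    Real.measurable_exp.comp (((comap_measurable (b (t + 1))).sub_const θ).const_mul l)
  have hbm : Measurable (b (t + 1)) := (hb _).mono (ℱ.le _) le_rfl
  -- Whether arm `i` is pulled in round `t + 1` is decided by the past and the coins, of which `b (t
  -- + 1)` is independent.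
  have hind : IndepFun (A.indicator W) Y P := by
    rw [IndepFun_iff_Indep]
    exact indep_of_indep_of_le_left (indep_of_indep_of_le_right (hbi t).symm hYm.comap_le)
      hfm.comap_le
  have hmul : P[A.indicator W * Y] = P[A.indicator W] * P[Y] :=
    hind.integral_mul_eq_mul_integral (hfm.mono hle le_rfl).aestronglyMeasurable
      (hYm.mono hbm.comap_le le_rfl).aestronglyMeasurable
  have heq : R.expScore i b l θ (t + 1) =
      fun ω => W ω - A.indicator W ω + (A.indicator W * Y) ω := by
    funext ω
    rw [expScore_succ]
    by_cases h : R.arm (t + 1) ω = i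
    · have : ω ∈ A := h
      simp [h, this, hW, hY]
    · have : ω ∉ A := h
      simp [h, this, hW]
  have hprod : Integrable (A.indicator W * Y) P := by
    have : A.indicator W * Y = fun ω => R.expScore i b l θ (t + 1) ω - (W ω - A.indicator W ω) := by
      rw [heq]; funext ω; ring
    rw [this]
    exact (hG.integrable_expScore i hb hb01 l θ (t + 1)).sub (hWint.sub hfint)
  calc P[R.expScore i b l θ (t + 1)]
      = ∫ ω, W ω - A.indicator W ω + (A.indicator W * Y) ω ∂P := by rw [heq]
    _ = P[W] - P[A.indicator W] + P[A.indicator W] * P[Y] := by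
        rw [integral_add (f := fun ω => W ω - A.indicator W ω) (hWint.sub hfint) hprod, hmul,
          integral_sub hWint hfint]
    _ = _ := by ring

/-- Only the pulls forced by exploration are kept: their event has probability `c / (t + 1)` and is
independent of the past, unlike exploitation, which may correlate with the score. -/
theorem integral_expScore_mul_le [IsProbabilityMeasure P]
    (hG : R.IsMedEpsGreedy P ℱ c) (i : Fin K) {b : ℕ → Ω → ℝ}
    (hb : ∀ t, Measurable[ℱ t] (b t)) (hb01 : ∀ t ω, b t ω ∈ Set.Icc (0 : ℝ) 1)
    (l θ : ℝ) {t : ℕ} (ht : ⌈c⌉₊ * K ≤ t) :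
    P[R.expScore i b l θ t] * (c / ((t + 1 : ℕ) : ℝ))
      ≤ P[{ω | R.arm (t + 1) ω = i}.indicator (R.expScore i b l θ t)] := by
  set W := R.expScore i b l θ t with hW
  set E := {ω | R.explore (t + 1) ω = true ∧ R.pick (t + 1) ω = i} with hE
  have hEm : MeasurableSet[R.coins (t + 1)] E := R.explorePick_measurableSet _ _
  have hcle : R.coins (t + 1) ≤ mΩ := (hG.coins_le _).trans (ℱ.le _)
  have hWm := hG.expScore_adapted i hb l θ t
  have hWint : Integrable W P := hG.integrable_expScore i hb hb01 l θ t
  have hone : Measurable[R.coins (t + 1)] (E.indicator fun _ => (1 : ℝ)) :=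
    measurable_const.indicator hEm
  have hind : IndepFun W (E.indicator fun _ => (1 : ℝ)) P := by
    rw [IndepFun_iff_Indep]
    exact indep_of_indep_of_le_left (indep_of_indep_of_le_right (hG.coins_indep t ht).symm
      hone.comap_le) hWm.comap_le
  have hmul : P[W * E.indicator fun _ => (1 : ℝ)] = P[W] * P[E.indicator fun _ => (1 : ℝ)] :=
    hind.integral_mul_eq_mul_integral (hWm.mono (ℱ.le _) le_rfl).aestronglyMeasurable
      (hone.mono hcle le_rfl).aestronglyMeasurable
  have hEp : P[E.indicator fun _ => (1 : ℝ)] = c / ((t + 1 : ℕ) : ℝ) := by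
    rw [integral_indicator_const _ (hcle _ hEm), hE, hG.explorePick_prob ht i]
    simp
  have hAm : MeasurableSet {ω | R.arm (t + 1) ω = i} :=
    (hG.past_sup_coins_le t).trans (ℱ.le _) _ (hG.arm_meas t (measurableSet_singleton i))
  rw [← hEp, ← hmul]
  have hWE : W * (E.indicator fun _ => (1 : ℝ)) = E.indicator W := by
    funext ω
    by_cases h : ω ∈ E <;> simp [h]
  rw [hWE]
  refine integral_mono (hWint.indicator (hcle _ hEm)) (hWint.indicator hAm) fun ω => ?_
  refine Set.indicator_le_indicator_of_subset ?_ (fun ω => (R.expScore_pos i b l θ t ω).le) ω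
  intro ω hω
  exact (hG.arm_explore t ht ω hω.1).trans hω.2

theorem measurableSet_le_sum_pulls (hG : R.IsMedEpsGreedy P ℱ c) (i : Fin K)
    {b : ℕ → Ω → ℝ} (hb : ∀ t, Measurable[ℱ t] (b t)) (θ : ℝ) (t : ℕ) :
    MeasurableSet {ω | θ * (R.pullRounds i t ω).card ≤ ∑ τ ∈ R.pullRounds i t ω, b τ ω} := by
  -- The sum ranges over a random index set; rewriting the event through the score with `l = 1`
  -- makes it visibly measurable.
  have h : {ω | θ * (R.pullRounds i t ω).card ≤ ∑ τ ∈ R.pullRounds i t ω, b τ ω}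
      = {ω | 1 ≤ R.expScore i b 1 θ t ω} := by
    ext ω
    simp only [Set.mem_ofPred_eq, expScore_eq, one_mul, Real.one_le_exp_iff, sub_nonneg]
  rw [h]
  exact measurableSet_le measurable_const
    ((hG.expScore_adapted i hb 1 θ t).mono (ℱ.le t) le_rfl)

/-- The total probability that the average of the `b τ` over the pulls of arm `i` exceeds a level
above their mean. -/
theorem sum_measureReal_le [IsProbabilityMeasure P]
    (hG : R.IsMedEpsGreedy P ℱ c) (hc : 40 < c) (i : Fin K)
    {b : ℕ → Ω → ℝ} (hb : ∀ t, Measurable[ℱ t] (b t))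
    (hb01 : ∀ t ω, b t ω ∈ Set.Icc (0 : ℝ) 1)
    (hbi : ∀ t, Indep (MeasurableSpace.comap (b (t + 1)) inferInstance)
      (ℱ t ⊔ R.coins (t + 1)) P) {p θ : ℝ} (hp : ∀ t, P[b (t + 1)] = p) (hpθ : p < θ)
    (hcθ : 1 / c < (θ - p) ^ 2) (T : ℕ) :
    ∑ t ∈ Finset.Ico (⌈c⌉₊ * K) T, P.real {ω | θ * (R.pullRounds i t ω).card
        ≤ ∑ τ ∈ R.pullRounds i t ω, b τ ω} ≤ 2 * (⌈c⌉₊ * K : ℕ) := by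
  set l := 4 * (θ - p) with hl
  set w : ℕ → ℝ := fun t => P[R.expScore i b l θ t] with hw
  have hc0 : 0 < c := by linarith
  have hl0 : 0 < l := by rw [hl]; linarith
  have hint := fun t => hG.integrable_expScore i hb hb01 l θ t
  have hpos : ∀ t ω, 0 ≤ R.expScore i b l θ t ω := fun t ω => (R.expScore_pos i b l θ t ω).le
  have hbad : ∀ t, P.real {ω | θ * (R.pullRounds i t ω).card
        ≤ ∑ τ ∈ R.pullRounds i t ω, b τ ω} ≤ w t := by
    intro t
    have h := mul_meas_ge_le_integral_of_nonneg (Filter.Eventually.of_forall (hpos t)) (hint t) 1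
    rw [one_mul] at h
    refine le_trans (measureReal_mono fun ω hω => ?_) h
    have hω' : θ * (R.pullRounds i t ω).card ≤ ∑ τ ∈ R.pullRounds i t ω, b τ ω := hω
    change 1 ≤ R.expScore i b l θ t ω
    rw [expScore_eq, Real.one_le_exp_iff]
    exact mul_nonneg hl0.le (by linarith)
  have hq : ∀ t, 3 / 2 / c ≤ 1 - ∫ ω, Real.exp (l * (b (t + 1) ω - θ)) ∂P := by
    intro t
    have h := integral_exp_sub_le (P := P) ((hb (t + 1)).mono (ℱ.le _) le_rfl) (hb01 (t + 1)) θ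
    rw [hp t] at h
    linarith [exp_neg_two_mul_le hc hcθ]
  -- This holds in the initial rounds too, where the exploration law is not available, and carries
  -- `w 0 = 1` to the start of the sum.
  have hdec : ∀ t, w (t + 1) ≤ w t := by
    intro t
    simp only [hw]
    rw [hG.integral_expScore_succ i hb hb01 hbi l θ t]
    have h1 : 0 ≤ P[{ω | R.arm (t + 1) ω = i}.indicator (R.expScore i b l θ t)] :=
      integral_nonneg fun ω => Set.indicator_nonneg (fun ω _ => hpos t ω) ω
    have h2 : 0 ≤ 3 / 2 / c := by positivity
    have := mul_nonneg (h2.trans (hq t)) h1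
    linarith
  refine (Finset.sum_le_sum fun t _ => hbad t).trans (sum_Ico_le_of_ratio
    (fun t => integral_nonneg (hpos t)) ?_ ?_ T)
  · refine (antitone_nat_of_succ_le hdec (Nat.zero_le _)).trans ?_
    simp [hw, expScore]
  · intro t ht
    have h0 : 0 ≤ w t := integral_nonneg (hpos t)
    have h1 := hG.integral_expScore_mul_le i hb hb01 l θ ht
    have h2 := mul_le_mul (hq t) h1 (by positivity) ((by positivity : 0 ≤ 3 / 2 / c).trans (hq t))
    have h3 := hG.integral_expScore_succ i hb hb01 hbi l θ t
    have h4 : 3 / 2 / c * (w t * (c / ((t + 1 : ℕ) : ℝ))) = w t * (3 / 2 / ((t + 1 : ℕ) : ℝ)) := by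
      field_simp
    change w (t + 1) = w t - _ at h3
    change 3 / 2 / c * (w t * (c / ((t + 1 : ℕ) : ℝ))) ≤ _ at h2
    rw [mul_sub, mul_one]
    linarith

end IsMedEpsGreedy

end BanditRun

/-! ### Harmonic sums and tail inequalities -/

theorem sum_Ico_one_div_le_log {m T : ℕ} (hm : 1 ≤ m) (hT : 1 ≤ T) :
    ∑ t ∈ Finset.Ico m T, 1 / ((t + 1 : ℕ) : ℝ) ≤ Real.log T := by
  refine (Finset.sum_le_sum_of_subset_of_nonneg (Finset.Ico_subset_Ico_left hm)
    fun t _ _ => by positivity).trans ?_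
  induction T, hT using Nat.le_induction with
  | base => simp
  | succ t ht ih =>
    rw [Finset.sum_Ico_succ_top ht]
    have h0 : (0 : ℝ) < t := by exact_mod_cast ht
    have h := Real.log_le_sub_one_of_pos (x := (t : ℝ) / ((t + 1 : ℕ) : ℝ)) (by positivity)
    rw [Real.log_div h0.ne' (by positivity)] at h
    have h1 : (t : ℝ) / ((t + 1 : ℕ) : ℝ) - 1 = -(1 / ((t + 1 : ℕ) : ℝ)) := by
      push_cast
      field_simp
      ring
    linarith

/-- Markov's inequality for the number of events that occur. -/
theorem mul_measureReal_count_le {Ω ι : Type*} [MeasurableSpace Ω] {P : Measure Ω}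
    [IsProbabilityMeasure P] (s : Finset ι) {G : ι → Set Ω} (hG : ∀ t, MeasurableSet (G t))
    (a : ℝ) :
    a * P.real {ω | a ≤ ∑ t ∈ s, (G t).indicator (fun _ => (1 : ℝ)) ω}
      ≤ ∑ t ∈ s, P.real (G t) := by
  have hint : ∀ t ∈ s, Integrable ((G t).indicator fun _ => (1 : ℝ)) P := fun t _ =>
    (integrable_const _).indicator (hG t)
  refine (mul_meas_ge_le_integral_of_nonneg (Filter.Eventually.of_forall fun ω =>
    Finset.sum_nonneg fun t _ => Set.indicator_nonneg (fun _ _ => zero_le_one) ω)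
    (integrable_finsetSum s hint) a).trans ?_
  rw [integral_finsetSum s hint]
  refine Finset.sum_le_sum fun t _ => ?_
  rw [integral_indicator_const _ (hG t)]
  simp

/-- Chebyshev's inequality for a sum of pairwise independent variables with values in `[0, D]`. -/
theorem measureReal_sum_ge_le {Ω ι : Type*} [MeasurableSpace Ω] {P : Measure Ω}
    [IsProbabilityMeasure P] (s : Finset ι) {X : ι → Ω → ℝ} {D m δ : ℝ} (hD : 0 < D) (hδ : 0 < δ)
    (hX : ∀ t, Measurable (X t)) (hXD : ∀ t ω, X t ω ∈ Set.Icc 0 D)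
    (hind : Set.Pairwise (s : Set ι) fun t u => IndepFun (X t) (X u) P)
    (hm : ∑ t ∈ s, P[X t] = m) :
    P.real {ω | 2 * m + D / δ ≤ ∑ t ∈ s, X t ω} ≤ δ / 4 := by
  have hL2 : ∀ t, MemLp (X t) 2 P := fun t =>
    memLp_of_bounded (Filter.Eventually.of_forall (hXD t)) (hX t).aestronglyMeasurable 2
  have hint : ∀ t, Integrable (X t) P := fun t => (hL2 t).integrable (by norm_num)
  have hm0 : 0 ≤ m := hm ▸ Finset.sum_nonneg fun t _ => integral_nonneg fun ω => (hXD t ω).1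
  -- Uses `X² ≤ D X` on `[0, D]`.
  have hvar : variance (∑ t ∈ s, X t) P ≤ D * m := by
    rw [IndepFun.variance_sum (fun t _ => hL2 t) hind, ← hm, Finset.mul_sum]
    refine Finset.sum_le_sum fun t _ => ?_
    refine (variance_le_expectation_sq (hX t).aestronglyMeasurable).trans ?_
    rw [← integral_const_mul]
    refine integral_mono (hL2 t).integrable_sq ((hint t).const_mul D) fun ω => ?_
    have := hXD t ω
    simp only [Pi.pow_apply]
    nlinarith [this.1, this.2]
  have hmean : P[∑ t ∈ s, X t] = m := by
    rw [← hm, ← integral_finsetSum s fun t _ => hint t]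
    simp
  have ha : 0 < m + D / δ := by positivity
  have hcheb := meas_ge_le_variance_div_sq (memLp_finsetSum' s fun t _ => hL2 t) ha (μ := P)
  rw [hmean] at hcheb
  have h1 : P.real {ω | 2 * m + D / δ ≤ ∑ t ∈ s, X t ω}
      ≤ P.real {ω | m + D / δ ≤ |(∑ t ∈ s, X t) ω - m|} := by
    refine measureReal_mono fun ω hω => ?_
    simp only [Set.mem_ofPred_eq, Finset.sum_apply] at hω ⊢
    exact le_trans (by linarith) (le_abs_self _)
  refine h1.trans ((ENNReal.toReal_le_of_le_ofReal
    (div_nonneg (variance_nonneg _ _) (sq_nonneg _)) hcheb).trans ?_)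
  rw [div_le_iff₀ (by positivity)]
  refine hvar.trans ?_
  -- By AM-GM, `(m + D/δ)² ≥ 4 m D/δ`, which turns the variance bound `D m` into `δ/4`.
  have h2 : 0 ≤ (m - D / δ) ^ 2 := sq_nonneg _
  have h3 : δ * (D / δ) = D := by field_simp
  nlinarith

/-! ### Medians under attack and misleading rounds -/

namespace BanditRun

variable {K : ℕ} {Ω : Type*}

/-- In the worst case every attacked observation lands in `B`; the attack values thus drop out of
the analysis. -/
theorem card_filter_observed_le (R : BanditRun K Ω) (i : Fin K) (t : ℕ) (ω : Ω) (B : Set ℝ)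
    [DecidablePred (· ∈ B)] :
    (((R.pullRounds i t ω).filter fun τ => R.observed τ i ω ∈ B).card : ℝ)
      ≤ (∑ τ ∈ R.pullRounds i t ω, B.indicator (fun _ => (1 : ℝ)) (R.clean τ i ω))
        + ∑ τ ∈ R.pullRounds i t ω, if R.attacked τ ω = true then (1 : ℝ) else 0 := by
  rw [Finset.card_filter, ← Finset.sum_add_distrib]
  push_cast
  refine Finset.sum_le_sum fun τ _ => ?_
  have h0 : 0 ≤ B.indicator (fun _ => (1 : ℝ)) (R.clean τ i ω) :=
    Set.indicator_nonneg (fun _ _ => zero_le_one) _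
  by_cases ha : R.attacked τ ω = true
  · simp only [ha, if_true]
    split_ifs <;> linarith
  · have : R.observed τ i ω = R.clean τ i ω := by simp [observed, ha]
    rw [this]
    by_cases hB : R.clean τ i ω ∈ B <;> simp [ha, hB]

/-- The values of the rewards of arm `i` on the wrong side of `x₀`. -/
def wrongSide (istar : Fin K) (x₀ : ℝ) (i : Fin K) : Set ℝ :=
  if i = istar then Set.Iic x₀ else Set.Ioi x₀

theorem measurableSet_wrongSide (istar : Fin K) (x₀ : ℝ) (i : Fin K) :
    MeasurableSet (wrongSide istar x₀ i) := by
  unfold wrongSide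
  split_ifs
  exacts [measurableSet_Iic, measurableSet_Ioi]

/-- After round `t`, the proportion of wrong clean rewards or of attacks among the pulls of some
arm is too large. -/
def misleading (R : BanditRun K Ω) (istar : Fin K) (x₀ s : ℝ) (t : ℕ) : Set Ω :=
  ⋃ i : Fin K,
    {ω | (1 / 2 - s) * (R.pullRounds i t ω).card ≤ ∑ τ ∈ R.pullRounds i t ω,
        (wrongSide istar x₀ i).indicator (fun _ => (1 : ℝ)) (R.clean τ i ω)} ∪
    {ω | s * (R.pullRounds i t ω).card ≤ ∑ τ ∈ R.pullRounds i t ω,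
        if R.attacked τ ω = true then (1 : ℝ) else 0}

open Classical in
theorem card_filter_wrongSide_lt (R : BanditRun K Ω) {istar : Fin K} {x₀ s : ℝ} {t : ℕ} {ω : Ω}
    (hω : ω ∉ R.misleading istar x₀ s t) (i : Fin K) :
    (((R.pullRounds i t ω).filter fun τ => R.observed τ i ω ∈ wrongSide istar x₀ i).card : ℝ)
      < ((R.pullRounds i t ω).card : ℝ) / 2 := by
  simp only [misleading, Set.mem_iUnion, Set.mem_union, Set.mem_ofPred_eq, not_exists, not_or,
    not_le] at hω
  have h := R.card_filter_observed_le i t ω (wrongSide istar x₀ i)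
  have := (hω i).1
  have := (hω i).2
  linarith

theorem lt_med_best (R : BanditRun K Ω) {istar : Fin K} {x₀ s : ℝ} {t : ℕ} {ω : Ω}
    (hω : ω ∉ R.misleading istar x₀ s t) : x₀ < R.med istar t ω := by
  classical
  refine lt_sampleMedian (lt_of_le_of_lt (le_of_eq ?_) (R.card_filter_wrongSide_lt hω istar))
  congr 2
  ext τ
  simp [wrongSide]

theorem med_le (R : BanditRun K Ω) {istar : Fin K} {x₀ s : ℝ} {t : ℕ} {ω : Ω}
    (hω : ω ∉ R.misleading istar x₀ s t) {j : Fin K} (hj : j ≠ istar) : R.med j t ω ≤ x₀ := by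
  classical
  have h := R.card_filter_wrongSide_lt hω j
  -- An arm without pulls makes the round misleading, since both defining inequalities read `0 ≤ 0`;
  -- the meaningless median of an empty sample never occurs here.
  have hne : (R.pullRounds j t ω).Nonempty := by
    rw [← Finset.card_pos]
    have : (0 : ℝ) < (R.pullRounds j t ω).card := by
      have : (0 : ℝ) ≤ ((R.pullRounds j t ω).filter
        fun τ => R.observed τ j ω ∈ wrongSide istar x₀ j).card := by positivity
      linarith
    exact_mod_cast this
  refine sampleMedian_le hne ?_
  have hsum := Finset.card_filter_add_card_filter_not (s := R.pullRounds j t ω)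
    fun τ => R.observed τ j ω ≤ x₀
  have heq : (R.pullRounds j t ω).filter (fun τ => R.observed τ j ω ∈ wrongSide istar x₀ j)
      = (R.pullRounds j t ω).filter fun τ => ¬ R.observed τ j ω ≤ x₀ := by
    ext τ
    simp [wrongSide, hj]
  rw [heq] at h
  have : (((R.pullRounds j t ω).filter fun τ => R.observed τ j ω ≤ x₀).card : ℝ)
      + ((R.pullRounds j t ω).filter fun τ => ¬ R.observed τ j ω ≤ x₀).card
      = (R.pullRounds j t ω).card := by exact_mod_cast hsum
  linarith

variable [mΩ : MeasurableSpace Ω] {P : Measure Ω} {ℱ : Filtration ℕ mΩ}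
  {R : BanditRun K Ω} {ν : Fin K → Measure ℝ} {ρ c : ℝ}

theorem IsMedEpsGreedy.arm_eq_of_exploit (hG : R.IsMedEpsGreedy P ℱ c) {istar : Fin K} {x₀ s : ℝ}
    {t : ℕ} {ω : Ω} (ht : ⌈c⌉₊ * K ≤ t) (he : R.explore (t + 1) ω = false)
    (hω : ω ∉ R.misleading istar x₀ s t) : R.arm (t + 1) ω = istar := by
  by_contra h
  have h1 := hG.arm_exploit t ht ω he istar
  have h2 := R.lt_med_best hω
  have h3 := R.med_le hω h
  linarith

theorem measurableSet_misleading (hA : R.IsAttackedBandit P ℱ ν ρ) (hG : R.IsMedEpsGreedy P ℱ c)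
    (istar : Fin K) (x₀ s : ℝ) (t : ℕ) : MeasurableSet (R.misleading istar x₀ s t) := by
  refine MeasurableSet.iUnion fun i => MeasurableSet.union ?_ ?_
  · exact hG.measurableSet_le_sum_pulls i (fun u => (measurable_const.indicator
      (measurableSet_wrongSide istar x₀ i)).comp (hA.clean_meas u i)) _ t
  · exact hG.measurableSet_le_sum_pulls i (fun u => (measurable_of_finite
      fun a : Bool => if a = true then (1 : ℝ) else 0).comp (hA.attacked_meas u)) _ t

theorem measureReal_wrongSide [∀ i, IsProbabilityMeasure (ν i)] (istar : Fin K) (x₀ : ℝ)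
    (i : Fin K) : (ν i).real (wrongSide istar x₀ i)
      = if i = istar then cdf (ν i) x₀ else 1 - cdf (ν i) x₀ := by
  unfold wrongSide
  split_ifs
  · rw [cdf_eq_real]
  · rw [cdf_eq_real, ← Set.compl_Iic, probReal_compl_eq_one_sub measurableSet_Iic]

theorem sum_misleading_le [∀ i, IsProbabilityMeasure (ν i)] [IsProbabilityMeasure P]
    (hA : R.IsAttackedBandit P ℱ ν ρ) (hG : R.IsMedEpsGreedy P ℱ c)
    {istar : Fin K} {x₀ s : ℝ} (hc : 40 < c)
    (hbest : cdf (ν istar) x₀ < 1 / 2 - s) (hother : ∀ j, j ≠ istar → 1 / 2 + s < cdf (ν j) x₀)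
    (hρ : ρ < s) (hcother : ∀ j, j ≠ istar → 4 / (cdf (ν j) x₀ - 1 / 2 - s) ^ 2 < c)
    (hcbest : 4 / (1 / 2 - s - cdf (ν istar) x₀) ^ 2 < c) (hcρ : 1 / (s - ρ) ^ 2 < c) (T : ℕ) :
    ∑ t ∈ Finset.Ico (⌈c⌉₊ * K) T, P.real (R.misleading istar x₀ s t)
      ≤ 4 * (K : ℝ) ^ 2 * ⌈c⌉₊ := by
  have hc0 : 0 < c := by linarith
  have hclean : ∀ i : Fin K, ∑ t ∈ Finset.Ico (⌈c⌉₊ * K) T,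
      P.real {ω | (1 / 2 - s) * (R.pullRounds i t ω).card ≤ ∑ τ ∈ R.pullRounds i t ω,
        (wrongSide istar x₀ i).indicator (fun _ => (1 : ℝ)) (R.clean τ i ω)}
      ≤ 2 * (⌈c⌉₊ * K : ℕ) := by
    intro i
    have hBm := measurableSet_wrongSide istar x₀ i
    have hind : Measurable ((wrongSide istar x₀ i).indicator fun _ => (1 : ℝ)) :=
      measurable_const.indicator hBm
    -- For `i ≠ istar` the wrong side has mass `1 - F_i(x₀)`, so the gap to `1/2 - s` is `F_i(x₀) -
    -- 1/2 - s`.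
    have hp : (ν i).real (wrongSide istar x₀ i) < 1 / 2 - s ∧
        1 / c < (1 / 2 - s - (ν i).real (wrongSide istar x₀ i)) ^ 2 := by
      rw [measureReal_wrongSide]
      split_ifs with h
      · subst h
        refine ⟨hbest, ?_⟩
        have h0 : 0 < (1 / 2 - s - cdf (ν i) x₀) ^ 2 := by
          have : 0 < 1 / 2 - s - cdf (ν i) x₀ := by linarith
          positivity
        rw [div_lt_iff₀ h0] at hcbest
        rw [div_lt_iff₀ hc0]
        linarith
      · have h1 := hother i h
        have h2 := hcother i h
        have h0 : 0 < (cdf (ν i) x₀ - 1 / 2 - s) ^ 2 := by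
          have : 0 < cdf (ν i) x₀ - 1 / 2 - s := by linarith
          positivity
        refine ⟨by linarith, ?_⟩
        rw [div_lt_iff₀ h0] at h2
        rw [div_lt_iff₀ hc0]
        nlinarith
    refine hG.sum_measureReal_le hc i
      (b := fun u ω => (wrongSide istar x₀ i).indicator (fun _ => (1 : ℝ)) (R.clean u i ω))
      (fun u => hind.comp (hA.clean_meas u i))
      (fun u ω => ?_) (fun u => ?_) (fun u => ?_) hp.1 hp.2 T
    · by_cases h : R.clean u i ω ∈ wrongSide istar x₀ i <;> simp [h]
    · exact indep_of_indep_of_le_left (hA.clean_indep u i)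
        (hind.comp (comap_measurable (R.clean (u + 1) i))).comap_le
    · have hm : Measurable (R.clean (u + 1) i) := (hA.clean_meas _ i).mono (ℱ.le _) le_rfl
      rw [← hA.clean_law u i, map_measureReal_apply hm hBm,
        ← integral_map hm.aemeasurable hind.aestronglyMeasurable, integral_indicator_const _ hBm,
        map_measureReal_apply hm hBm]
      simp
  have hatt : ∀ i : Fin K, ∑ t ∈ Finset.Ico (⌈c⌉₊ * K) T,
      P.real {ω | s * (R.pullRounds i t ω).card ≤ ∑ τ ∈ R.pullRounds i t ω,
        if R.attacked τ ω = true then (1 : ℝ) else 0} ≤ 2 * (⌈c⌉₊ * K : ℕ) := by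
    intro i
    have hind : Measurable fun a : Bool => if a = true then (1 : ℝ) else 0 := measurable_of_finite _
    have hg : 0 < (s - ρ) ^ 2 := by
      have : 0 < s - ρ := by linarith
      positivity
    refine hG.sum_measureReal_le hc i
      (b := fun u ω => if R.attacked u ω = true then (1 : ℝ) else 0)
      (fun u => hind.comp (hA.attacked_meas u))
      (fun u ω => ?_) (fun u => ?_) (p := ρ) (fun u => ?_) hρ ?_ T
    · split_ifs <;> simp
    · exact indep_of_indep_of_le_left (hA.attacked_indep u)
        (hind.comp (comap_measurable (R.attacked (u + 1)))).comap_le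
    · have hm : MeasurableSet {ω | R.attacked (u + 1) ω = true} :=
        ℱ.le _ _ (hA.attacked_meas (u + 1) (measurableSet_singleton true))
      rw [← hA.attacked_prob u]
      calc _ = ∫ ω, {ω | R.attacked (u + 1) ω = true}.indicator (fun _ => (1 : ℝ)) ω ∂P := by
            refine integral_congr_ae (Filter.Eventually.of_forall fun ω => ?_)
            simp [Set.indicator_apply]
        _ = _ := by rw [integral_indicator_const _ hm]; simp
    · rw [div_lt_iff₀ hg] at hcρ
      rw [div_lt_iff₀ hc0]
      linarith
  calc ∑ t ∈ Finset.Ico (⌈c⌉₊ * K) T, P.real (R.misleading istar x₀ s t)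
      ≤ ∑ t ∈ Finset.Ico (⌈c⌉₊ * K) T, ∑ i : Fin K,
        (P.real {ω | (1 / 2 - s) * (R.pullRounds i t ω).card ≤ ∑ τ ∈ R.pullRounds i t ω,
          (wrongSide istar x₀ i).indicator (fun _ => (1 : ℝ)) (R.clean τ i ω)}
        + P.real {ω | s * (R.pullRounds i t ω).card ≤ ∑ τ ∈ R.pullRounds i t ω,
          if R.attacked τ ω = true then (1 : ℝ) else 0}) := by
        refine Finset.sum_le_sum fun t _ => (measureReal_iUnion_fintype_le _).trans ?_
        exact Finset.sum_le_sum fun i _ => measureReal_union_le _ _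
    -- Each of the `K` arms contributes two events, each of total probability at most `2 ⌈c⌉ K`.
    _ ≤ ∑ _i : Fin K, (2 * ((⌈c⌉₊ * K : ℕ) : ℝ) + 2 * ((⌈c⌉₊ * K : ℕ) : ℝ)) := by
        rw [Finset.sum_comm]
        refine Finset.sum_le_sum fun i _ => ?_
        rw [Finset.sum_add_distrib]
        exact add_le_add (hclean i) (hatt i)
    _ = _ := by
        simp
        ring

end BanditRun

/-! ### Decomposition of the regret and its tail bound -/

namespace BanditRun

variable {K : ℕ} {Ω : Type*}

/-- The gap of the arm explored in round `t`; it is `0` if the player does not explore. -/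
noncomputable def exploreGap (R : BanditRun K Ω) (Δ : Fin K → ℝ) (t : ℕ) (ω : Ω) : ℝ :=
  if R.explore t ω = true then Δ (R.pick t ω) else 0

theorem exploreGap_eq_sum (R : BanditRun K Ω) (Δ : Fin K → ℝ) (t : ℕ) (ω : Ω) :
    R.exploreGap Δ t ω = ∑ j, {ω | R.explore t ω = true ∧ R.pick t ω = j}.indicator
      (fun _ => Δ j) ω := by
  unfold exploreGap
  by_cases h : R.explore t ω = true <;> simp [h, Set.indicator_apply]

theorem measurable_exploreGap (R : BanditRun K Ω) (Δ : Fin K → ℝ) (t : ℕ) :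
    Measurable[R.coins t] (R.exploreGap Δ t) := by
  have h : R.exploreGap Δ t = fun ω => ∑ j,
      {ω | R.explore t ω = true ∧ R.pick t ω = j}.indicator (fun _ => Δ j) ω :=
    funext (R.exploreGap_eq_sum Δ t)
  rw [h]
  exact Finset.measurable_fun_sum (m := R.coins t) _ fun j _ =>
    measurable_const.indicator (R.explorePick_measurableSet t j)

theorem regret_eq_sum (R : BanditRun K Ω) {ν : Fin K → Measure ℝ} {istar : Fin K}
    {Δ : Fin K → ℝ} (hΔ : ∀ j, Δ j = rewardMean (ν istar) - rewardMean (ν j)) (T : ℕ) (ω : Ω) :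
    R.regret ν istar T ω = ∑ t ∈ Finset.range T, Δ (R.arm (t + 1) ω) := by
  unfold regret
  simp_rw [hΔ]
  rw [Finset.sum_sub_distrib, Finset.sum_const, Finset.card_range, nsmul_eq_mul, mul_comm]
  congr 1
  rw [Finset.range_eq_Ico, Finset.sum_Ico_add' (fun t => rewardMean (ν (R.arm t ω))) 0 T 1]
  congr 1

variable [mΩ : MeasurableSpace Ω] {P : Measure Ω} {ℱ : Filtration ℕ mΩ}
  {R : BanditRun K Ω} {ν : Fin K → Measure ℝ} {ρ c : ℝ}

theorem IsMedEpsGreedy.integral_exploreGap [IsProbabilityMeasure P] (hG : R.IsMedEpsGreedy P ℱ c)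
    (Δ : Fin K → ℝ) {t : ℕ} (ht : ⌈c⌉₊ * K ≤ t) :
    P[R.exploreGap Δ (t + 1)] = c * (∑ j, Δ j) * (1 / ((t + 1 : ℕ) : ℝ)) := by
  have hm : ∀ j, MeasurableSet {ω | R.explore (t + 1) ω = true ∧ R.pick (t + 1) ω = j} :=
    fun j => (hG.coins_le _).trans (ℱ.le _) _ (R.explorePick_measurableSet _ j)
  simp_rw [exploreGap_eq_sum]
  rw [integral_finsetSum _ fun j _ => (integrable_const _).indicator (hm j)]
  simp_rw [integral_indicator_const _ (hm _), hG.explorePick_prob ht, smul_eq_mul]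
  rw [← Finset.mul_sum]
  ring

/-- The coins of the earlier round belong to the past of the later one. Pairwise independence
suffices for Chebyshev. -/
theorem IsMedEpsGreedy.indepFun_exploreGap (hG : R.IsMedEpsGreedy P ℱ c) (Δ : Fin K → ℝ)
    {t u : ℕ} (ht : ⌈c⌉₊ * K ≤ t) (hu : ⌈c⌉₊ * K ≤ u) (h : t ≠ u) :
    IndepFun (R.exploreGap Δ (t + 1)) (R.exploreGap Δ (u + 1)) P := by
  wlog htu : t < u generalizing t u
  · exact (this hu ht h.symm (by omega)).symm
  rw [IndepFun_iff_Indep]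
  refine indep_of_indep_of_le_left (indep_of_indep_of_le_right (hG.coins_indep u hu).symm
    (R.measurable_exploreGap Δ (u + 1)).comap_le) ?_
  exact (R.measurable_exploreGap Δ (t + 1)).comap_le.trans
    ((hG.coins_le (t + 1)).trans (ℱ.mono htu))

theorem IsMedEpsGreedy.regret_le (hG : R.IsMedEpsGreedy P ℱ c) {istar : Fin K} {x₀ s D : ℝ}
    {Δ : Fin K → ℝ} (hΔ : ∀ j, Δ j = rewardMean (ν istar) - rewardMean (ν j))
    (hΔ0 : ∀ j, 0 ≤ Δ j) (hΔD : ∀ j, Δ j ≤ D) (T : ℕ) (ω : Ω) :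
    R.regret ν istar T ω ≤ (⌈c⌉₊ * K : ℕ) * D
      + ∑ t ∈ Finset.Ico (⌈c⌉₊ * K) T, R.exploreGap Δ (t + 1) ω
      + (∑ t ∈ Finset.Ico (⌈c⌉₊ * K) T,
          (R.misleading istar x₀ s t).indicator (fun _ => (1 : ℝ)) ω) * D := by
  have hD : 0 ≤ D := (hΔ0 istar).trans (hΔD istar)
  rw [R.regret_eq_sum hΔ]
  -- Only an inclusion, as `T` may fall within the initial rounds; nonnegative gaps make it enough.
  have hsub : Finset.range T ⊆ Finset.range (⌈c⌉₊ * K) ∪ Finset.Ico (⌈c⌉₊ * K) T := by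
    intro t ht
    simp only [Finset.mem_union, Finset.mem_range, Finset.mem_Ico] at ht ⊢
    omega
  have hdisj : Disjoint (Finset.range (⌈c⌉₊ * K)) (Finset.Ico (⌈c⌉₊ * K) T) := by
    rw [Finset.disjoint_left]
    intro t ht
    simp only [Finset.mem_range, Finset.mem_Ico] at ht ⊢
    omega
  refine (Finset.sum_le_sum_of_subset_of_nonneg hsub fun t _ _ => hΔ0 _).trans ?_
  rw [Finset.sum_union hdisj, add_assoc, Finset.sum_mul, ← Finset.sum_add_distrib]
  refine add_le_add ?_ (Finset.sum_le_sum fun t ht => ?_)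
  · refine (Finset.sum_le_card_nsmul _ _ D fun t _ => hΔD _).trans ?_
    rw [Finset.card_range, nsmul_eq_mul]
  · have ht' := (Finset.mem_Ico.1 ht).1
    have hpos : 0 ≤ (R.misleading istar x₀ s t).indicator (fun _ => (1 : ℝ)) ω * D :=
      mul_nonneg (Set.indicator_nonneg (fun _ _ => zero_le_one) _) hD
    by_cases he : R.explore (t + 1) ω = true
    · rw [hG.arm_explore t ht' ω he]
      simp only [exploreGap, he, if_true]
      linarith
    · by_cases hω : ω ∈ R.misleading istar x₀ s t
      · simpa [exploreGap, he, hω] using hΔD _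
      · rw [hG.arm_eq_of_exploit ht' (by simpa using he) hω]
        have : Δ istar = 0 := by rw [hΔ]; ring
        simp [exploreGap, he, hω, this]

/-- The free bound `D` on the gaps serves both claims: `μ*` for the explicit bound, a function of
the gaps alone for the constant `M`. -/
theorem regret_whp [∀ i, IsProbabilityMeasure (ν i)] [IsProbabilityMeasure P]
    (hA : R.IsAttackedBandit P ℱ ν ρ) (hG : R.IsMedEpsGreedy P ℱ c)
    {istar : Fin K} {x₀ s D : ℝ} {Δ : Fin K → ℝ}
    (hΔ : ∀ j, Δ j = rewardMean (ν istar) - rewardMean (ν j))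
    (hΔ0 : ∀ j, 0 ≤ Δ j) (hΔD : ∀ j, Δ j ≤ D) (hc : 40 < c)
    (hbest : cdf (ν istar) x₀ < 1 / 2 - s) (hother : ∀ j, j ≠ istar → 1 / 2 + s < cdf (ν j) x₀)
    (hρ : ρ < s) (hcother : ∀ j, j ≠ istar → 4 / (cdf (ν j) x₀ - 1 / 2 - s) ^ 2 < c)
    (hcbest : 4 / (1 / 2 - s - cdf (ν istar) x₀) ^ 2 < c) (hcρ : 1 / (s - ρ) ^ 2 < c)
    {T : ℕ} {δ : ℝ} (hT : 1 ≤ T) (hδ0 : 0 < δ) (hδ1 : δ < 1) :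
    1 - δ ≤ P.real {ω | R.regret ν istar T ω ≤
      6 * (⌈c⌉₊ : ℝ) ^ 2 * (K : ℝ) ^ 3 / δ * D + 2 * c * (∑ j, Δ j) * Real.log T} := by
  have hD : 0 ≤ D := (hΔ0 istar).trans (hΔD istar)
  -- Chebyshev's bound needs `D > 0`; for `D = 0` all gaps vanish and so does the regret.
  rcases hD.eq_or_lt with rfl | hD
  · have hz : ∀ j, Δ j = 0 := fun j => le_antisymm (hΔD j) (hΔ0 j)
    have huniv : {ω | R.regret ν istar T ω ≤ 6 * (⌈c⌉₊ : ℝ) ^ 2 * (K : ℝ) ^ 3 / δ * 0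
        + 2 * c * (∑ j, Δ j) * Real.log T} = Set.univ := by
      refine Set.eq_univ_of_forall fun ω => ?_
      change R.regret ν istar T ω ≤ _
      rw [R.regret_eq_sum hΔ]
      simp [hz]
    rw [huniv, probReal_univ]
    linarith
  have hc0 : 0 < c := by linarith
  have hn : (41 : ℝ) ≤ ⌈c⌉₊ := by
    have : 40 < ⌈c⌉₊ := Nat.lt_ceil.2 (by exact_mod_cast hc)
    exact_mod_cast this
  have hK : (1 : ℝ) ≤ K := by exact_mod_cast istar.pos
  have ht0 : 1 ≤ ⌈c⌉₊ * K := Nat.mul_pos (Nat.ceil_pos.2 hc0) istar.pos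
  set I := Finset.Ico (⌈c⌉₊ * K) T with hI
  set E : ℝ := 4 * (K : ℝ) ^ 2 * ⌈c⌉₊ with hE
  have hE0 : 0 < E := by positivity
  set m : ℝ := ∑ t ∈ I, P[R.exploreGap Δ (t + 1)] with hm
  have hmle : m ≤ c * (∑ j, Δ j) * Real.log T := by
    rw [hm, Finset.sum_congr rfl fun t ht => hG.integral_exploreGap Δ (Finset.mem_Ico.1 ht).1,
      ← Finset.mul_sum]
    have := Finset.sum_nonneg fun j (_ : j ∈ Finset.univ) => hΔ0 j
    gcongr
    exact sum_Ico_one_div_le_log ht0 hT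
  have hexp : P.real {ω | 2 * m + D / δ ≤ ∑ t ∈ I, R.exploreGap Δ (t + 1) ω} ≤ δ / 4 := by
    refine measureReal_sum_ge_le I hD hδ0 (fun t => (R.measurable_exploreGap Δ (t + 1)).mono
      ((hG.coins_le _).trans (ℱ.le _)) le_rfl) (fun t ω => ?_) (fun t ht u hu htu => ?_) rfl
    · unfold exploreGap
      split_ifs
      · exact ⟨hΔ0 _, hΔD _⟩
      · exact ⟨le_rfl, hD.le⟩
    · exact hG.indepFun_exploreGap Δ (Finset.mem_Ico.1 ht).1 (Finset.mem_Ico.1 hu).1 htu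
  have hcount : P.real {ω | 2 * E / δ ≤ ∑ t ∈ I,
      (R.misleading istar x₀ s t).indicator (fun _ => (1 : ℝ)) ω} ≤ δ / 2 := by
    have h := (mul_measureReal_count_le (P := P) I
      (fun t => measurableSet_misleading hA hG istar x₀ s t) (2 * E / δ)).trans
      (sum_misleading_le hA hG hc hbest hother hρ hcother hcbest hcρ T)
    rw [← hE, mul_comm, ← le_div_iff₀ (by positivity)] at h
    refine h.trans (le_of_eq ?_)
    field_simp
  set good := {ω | R.regret ν istar T ω ≤ 6 * (⌈c⌉₊ : ℝ) ^ 2 * (K : ℝ) ^ 3 / δ * D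
    + 2 * c * (∑ j, Δ j) * Real.log T} with hgood
  have hcover : (Set.univ : Set Ω) ⊆ good
      ∪ ({ω | 2 * m + D / δ ≤ ∑ t ∈ I, R.exploreGap Δ (t + 1) ω}
      ∪ {ω | 2 * E / δ ≤ ∑ t ∈ I,
        (R.misleading istar x₀ s t).indicator (fun _ => (1 : ℝ)) ω}) := by
    intro ω _
    by_contra hω
    simp only [Set.mem_union, not_or, Set.mem_ofPred_eq, not_le] at hω
    obtain ⟨h1, h2, h3⟩ := hω
    refine h1 ?_
    change R.regret ν istar T ω ≤ _
    refine (hG.regret_le (x₀ := x₀) (s := s) hΔ hΔ0 hΔD T ω).trans ?_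
    have h4 := mul_le_mul_of_nonneg_right h3.le hD.le
    -- With `n = ⌈c⌉ ≥ 41`, each of `n K`, `1` and `2 E = 8 K² n` is at most `n² K³`, so the
    -- constant `6` leaves room.
    have h5 : ((⌈c⌉₊ * K : ℕ) : ℝ) * D + D / δ + 2 * E / δ * D
        ≤ 6 * (⌈c⌉₊ : ℝ) ^ 2 * (K : ℝ) ^ 3 / δ * D := by
      have hδ : 1 ≤ 1 / δ := by rw [le_div_iff₀ hδ0]; linarith
      set n : ℝ := (⌈c⌉₊ : ℝ)
      have hnK : 1 ≤ n * K := by nlinarith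
      have hnK2 : n * K ≤ n ^ 2 * K ^ 3 := by
        have : 1 ≤ n * K ^ 2 := by nlinarith
        nlinarith
      have hnK3 : 8 * (K ^ 2 * n) ≤ n ^ 2 * (K : ℝ) ^ 3 := by
        have : 8 ≤ n * K := by nlinarith
        have : 0 ≤ (K : ℝ) ^ 2 * n := by positivity
        nlinarith
      have h6 : n * K ≤ n * K * (1 / δ) := le_mul_of_one_le_right (by positivity) hδ
      have h7 : n * K + 1 / δ + 2 * E / δ ≤ 6 * n ^ 2 * (K : ℝ) ^ 3 / δ := by
        have : (n * K + 1 + 2 * E) * (1 / δ) ≤ 6 * n ^ 2 * (K : ℝ) ^ 3 * (1 / δ) := by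
          gcongr
          rw [hE]
          nlinarith
        calc _ ≤ n * K * (1 / δ) + 1 / δ + 2 * E / δ := by gcongr
          _ = (n * K + 1 + 2 * E) * (1 / δ) := by ring
          _ ≤ _ := this
          _ = _ := by ring
      calc _ = (n * K + 1 / δ + 2 * E / δ) * D := by push_cast; ring
        _ ≤ _ := by gcongr
    linarith
  have hone := (measureReal_mono hcover (μ := P)).trans (measureReal_union_le _ _)
  have htwo := measureReal_union_le (μ := P)
    {ω | 2 * m + D / δ ≤ ∑ t ∈ I, R.exploreGap Δ (t + 1) ω}
    {ω | 2 * E / δ ≤ ∑ t ∈ I, (R.misleading istar x₀ s t).indicator (fun _ => (1 : ℝ)) ω}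
  rw [probReal_univ] at hone
  linarith

end BanditRun

/-! ### The regret theorem -/

theorem theorem4 (K : ℕ) (c : ℝ) (Δ : Fin K → ℝ) :
    ∃ M : ℝ, 0 < M ∧
      ∀ (ν : Fin K → Measure ℝ) [∀ i, IsProbabilityMeasure (ν i)] (istar : Fin K)
        (s x₀ ρ : ℝ)
        {Ω : Type*} [mΩ : MeasurableSpace Ω] (P : Measure Ω) [IsProbabilityMeasure P]
        (ℱ : Filtration ℕ mΩ) (R : BanditRun K Ω),
        -- the arms have finite, nonnegative means; `istar` is the unique best arm; `Δ` are the gaps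
        (∀ i, Integrable (fun x : ℝ => x) (ν i)) →
        (∀ i, 0 ≤ rewardMean (ν i)) →
        (∀ j, j ≠ istar → rewardMean (ν j) < rewardMean (ν istar)) →
        (∀ j, Δ j = rewardMean (ν istar) - rewardMean (ν j)) →
        -- the assumption on the distribution functions
        0 < s → s < 1 →
        cdf (ν istar) x₀ < 1 / 2 - s →
        (∀ j, j ≠ istar → 1 / 2 + s < cdf (ν j) x₀) →
        -- the conditions on the attack probability and on the exploration parameter
        ρ < s →
        40 < c →
        (∀ j, j ≠ istar → 4 / (cdf (ν j) x₀ - 1 / 2 - s) ^ 2 < c) →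
        4 / (1 / 2 - s - cdf (ν istar) x₀) ^ 2 < c →
        1 / (s - ρ) ^ 2 < c →
        -- the attack model and the algorithm
        R.IsAttackedBandit P ℱ ν ρ →
        R.IsMedEpsGreedy P ℱ c →
        ∀ (T : ℕ) (δ : ℝ), 1 ≤ T → 0 < δ → δ < 1 →
          1 - δ ≤ P.real {ω | R.regret ν istar T ω ≤
              6 * (⌈c⌉₊ : ℝ) ^ 2 * (K : ℝ) ^ 3 / δ * rewardMean (ν istar)
                + (∑ j ∈ Finset.univ.erase istar, 2 * c * Δ j * Real.log T)
                + ∑ j ∈ Finset.univ.erase istar, 2 * c * Δ j} ∧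
          1 - δ ≤ P.real {ω | R.regret ν istar T ω ≤ M * (Real.log T + 1 / δ)} := by
  -- `M` is fixed before the arms, so `1 + ∑ Δ` replaces `μ*` as the bound on the gaps; absolute
  -- values are there because no signs are known yet.
  refine ⟨6 * (⌈c⌉₊ : ℝ) ^ 2 * (K : ℝ) ^ 3 * (1 + ∑ j, |Δ j|) + 2 * |c| * (∑ j, |Δ j|) + 1,
    by positivity, ?_⟩
  intro ν _ istar s x₀ ρ Ω mΩ P _ ℱ R hint hmean hbestmean hΔ hs0 hs1 hbest hother hρ hc hcother
    hcbest hcρ hA hG T δ hT hδ0 hδ1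
  have hc0 : 0 < c := by linarith
  have hΔstar : Δ istar = 0 := by rw [hΔ]; ring
  have hΔ0 : ∀ j, 0 ≤ Δ j := by
    intro j
    by_cases h : j = istar
    · rw [h, hΔstar]
    · rw [hΔ]; linarith [hbestmean j h]
  have hsum : ∑ j ∈ Finset.univ.erase istar, Δ j = ∑ j, Δ j := Finset.sum_erase _ hΔstar
  have hS0 : 0 ≤ ∑ j, Δ j := Finset.sum_nonneg fun j _ => hΔ0 j
  have hlog : 0 ≤ Real.log T := Real.log_natCast_nonneg T
  constructor
  · have h := BanditRun.regret_whp hA hG (D := rewardMean (ν istar)) hΔ hΔ0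
      (fun j => by rw [hΔ]; linarith [hmean j]) hc hbest hother hρ hcother hcbest hcρ hT hδ0 hδ1
    refine h.trans (measureReal_mono fun ω hω => ?_)
    rw [Set.mem_ofPred_eq] at hω ⊢
    refine hω.trans ?_
    rw [← Finset.sum_mul, ← Finset.mul_sum, hsum]
    have : 0 ≤ 2 * c * ∑ j, Δ j := by positivity
    linarith
  · have h := BanditRun.regret_whp hA hG (D := 1 + ∑ j, Δ j) hΔ hΔ0
      (fun j => by linarith [Finset.single_le_sum (fun j _ => hΔ0 j) (Finset.mem_univ j)])
      hc hbest hother hρ hcother hcbest hcρ hT hδ0 hδ1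
    refine h.trans (measureReal_mono fun ω hω => ?_)
    rw [Set.mem_ofPred_eq] at hω ⊢
    refine hω.trans ?_
    simp_rw [abs_of_nonneg (hΔ0 _), abs_of_pos hc0]
    set A : ℝ := 6 * (⌈c⌉₊ : ℝ) ^ 2 * (K : ℝ) ^ 3 * (1 + ∑ j, Δ j) with hAdef
    set B : ℝ := 2 * c * ∑ j, Δ j with hBdef
    have hA0 : 0 ≤ A := by positivity
    have hB0 : 0 ≤ B := by positivity
    have hδ : 0 < 1 / δ := by positivity
    have heq : 6 * (⌈c⌉₊ : ℝ) ^ 2 * (K : ℝ) ^ 3 / δ * (1 + ∑ j, Δ j) = A * (1 / δ) := by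
      rw [hAdef]; ring
    rw [heq]
    have h1 : 0 ≤ (A + 1) * Real.log T := by positivity
    have h2 : 0 ≤ (B + 1) * (1 / δ) := by positivity
    linarith
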